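/- A \emph{Turing machine with a Deutschian closed timelike curve} ($\mathrm{TM}_{\mathrm{CTC}}$) is a probabilistic Turing machine $M$ over the alphabet $\{0,1,\#\}$ (with an operation that sets the current square to $0$ or $1$ with probability $1/2$ each) whose memory consists of two registers: a causality-respecting register, which initially holds the input $x\in\{0,1\}^*$, and a CTC register, which initially holds a string $y\in\{0,1\}^*$. It is required that (i) for all $x,y\in\{0,1\}^*$, $M(x,y)$ halts with probability $1$, outputting $0$ or $1$; that is, for every $\varepsilon>0$ there is a $t$ such that $M(x,y)$ has halted after $t$ steps with probability at least $1-\varepsilon$. Let $S_x$ be the stochastic map from $\{0,1\}^*$ to itself that sends $y$ to the final contents of the CTC register when $M$ is run on $(x,y)$. A \emph{fixed-point} of $S_x$ is a probability distribution $\mathcal D$ on $\{0,1\}^*$ with $S_x(\mathcal D)=\mathcal D$. It is \emph{accepting} if $\Pr_{y\sim\mathcal D}[M(x,y)\text{ outputs }1]\ge 2/3$ and \emph{rejecting} if $\Pr_{y\sim\mathcal D}[M(x,y)\text{ outputs }0]\ge 2/3$ (the probabilities include the internal randomness of $M$). It is also required that, for every $x\in\{0,1\}^*$, (ii) $S_x$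 has at least one fixed-point, and (iii) either every fixed-point of $S_x$ is accepting ($M$ \emph{accepts} $x$), or every fixed-point of $S_x$ is rejecting ($M$ \emph{rejects} $x$). For a distribution $\mathcal D=(p_y)$ on $\{0,1\}^*$ let $|\mathcal D|=\sum_y p_y|y|$ be its expected string-length. \textbf{Theorem.} Let $\ell$ be any partial computable function that maps pairs $(\langle M\rangle,x)$, of a machine description and an input, to natural numbers. Then there is an algorithm (an ordinary one, without oracle) which, given $\langle M\rangle$ and $x$, halts and correctly decides whether $M$ accepts or rejects $x$, provided that $M$ is a $\mathrm{TM}_{\mathrm{CTC}}$, that $\ell(\langle M\rangle,x)$ is defined, and that $S_x$ has a fixed-point $\mathcal D$ with $|\mathcal D|\le\ell(\langle M\rangle,x)$. -/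

import Mathlib

open scoped ENNReal

namespace CTC

/-! ### Probabilistic two-register Turing machines -/

/-- The tape alphabet `{0, 1, #}`: `some false` is `0`, `some true` is `1`, and `none` is the
delimiter `#`. -/
abbrev Sym : Type := Option Bool

/-- Head movements. -/
inductive Move : Type
  | left
  | stay
  | right
  deriving DecidableEq

/-- The two registers of the machine: the causality-respecting register and the closed timelike
curve register. -/
inductive Register : Type
  | cr
  | ctc
  deriving DecidableEq

/-- The instructions of a machine. -/
inductive Instr : Type
  /-- Halt and output the given bit. -/
  | halt (out : Bool)
  /-- Set the square under the head of register `r` to `0` or `1` with probability `1/2` each, and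
  go to state `next`. -/
  | flip (r : Register) (next : ℕ)
  /-- Write `s₁` under the head of the causality-respecting register and move that head by `m₁`,
  write `s₂` under the head of the CTC register and move that head by `m₂`, and go to state
  `next`. -/
  | act (s₁ : Sym) (m₁ : Move) (s₂ : Sym) (m₂ : Move) (next : ℕ)
  deriving DecidableEq

/-- `Move` as a three-element type. -/
def Move.equivOption : Move ≃ Option Bool where
  toFun
    | .left => some false
    | .stay => none
    | .right => some true
  invFun
    | some false => .left
    | none => .stay
    | some true => .right
  left_inv m := by cases m <;> rfl
  right_inv o := by rcases o with _ | _ | _ <;> rfl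

/-- `Register` as a two-element type. -/
def Register.equivBool : Register ≃ Bool where
  toFun
    | .cr => false
    | .ctc => true
  invFun
    | false => .cr
    | true => .ctc
  left_inv r := by cases r <;> rfl
  right_inv b := by cases b <;> rfl

instance : Primcodable Move := Primcodable.ofEquiv _ Move.equivOption

instance : Primcodable Register := Primcodable.ofEquiv _ Register.equivBool

/-- `Instr` as a sum of products. -/
def Instr.equivSum : Instr ≃ Bool ⊕ ((Register × ℕ) ⊕ (Sym × Move × Sym × Move × ℕ)) where
  toFun
    | .halt b => .inl b
    | .flip r q => .inr (.inl (r, q))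
    | .act s₁ m₁ s₂ m₂ q => .inr (.inr (s₁, m₁, s₂, m₂, q))
  invFun
    | .inl b => .halt b
    | .inr (.inl (r, q)) => .flip r q
    | .inr (.inr (s₁, m₁, s₂, m₂, q)) => .act s₁ m₁ s₂ m₂ q
  left_inv i := by cases i <;> rfl
  right_inv x := by rcases x with _ | ⟨_, _⟩ | ⟨_, _, _, _, _⟩ <;> rfl

instance : Primcodable Instr := Primcodable.ofEquiv _ Instr.equivSum

/-- A (description of a) machine: a finite table of rules. The rule `((q, a, b), i)` says that in
state `q`, reading `a` in the causality-respecting register and `b` in the CTC register, the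
instruction `i` is carried out. The first rule that applies is used. The initial state is `0`. -/
abbrev Machine : Type := List ((ℕ × Sym × Sym) × Instr)

/-- The contents of a register: the binary string `str`, between two delimiters `#`, with the head
on square `pos`. Square `0` holds the left delimiter, the squares `1, …, str.length` hold the
string, and square `str.length + 1` holds the right delimiter, beyond which the head never goes. -/
structure Reg : Type where
  str : List Bool
  pos : ℕ

namespace Reg

/-- The register that holds the string `s`, with the head on the first square after the left
delimiter. -/
def ofString (s : List Bool) : Reg := ⟨s, 1⟩

/-- The symbol under the head. -/
def read (r : Reg) : Sym :=
  match r.pos with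
  | 0 => none
  | p + 1 => r.str[p]?

/-- Write a symbol under the head. Writing a bit over the right delimiter moves that delimiter one
square to the right, so that the string is expanded; writing `#` moves the right delimiter to the
square under the head, so that the string is contracted. The left delimiter marks the end of the
tape and is never overwritten. -/
def write (r : Reg) (s : Sym) : Reg :=
  match r.pos, s with
  | 0, _ => r
  | p + 1, some b => ⟨r.str.take p ++ b :: r.str.drop (p + 1), p + 1⟩
  | p + 1, none => ⟨r.str.take p, p + 1⟩

/-- Move the head by at most one square, between the left delimiter and the right one. -/
def move (r : Reg) : Move → Reg
  | .left => ⟨r.str, r.pos - 1⟩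
  | .stay => r
  | .right => ⟨r.str, min (r.pos + 1) (r.str.length + 1)⟩

end Reg

/-- A configuration: the control is either a running state `Sum.inl q`, or `Sum.inr b`, which means
that the machine has halted with output `b`. -/
structure Config : Type where
  ctl : ℕ ⊕ Bool
  cr : Reg
  ctc : Reg

/-- The initial configuration on the pair of strings `(x, y)`. -/
def init (x y : List Bool) : Config := ⟨.inl 0, .ofString x, .ofString y⟩

/-- Carry out one instruction, where `coin` is the random bit that is used by a `flip`. -/
def exec (coin : Bool) (c : Config) : Instr → Config
  | .halt b => ⟨.inr b, c.cr, c.ctc⟩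
  | .flip .cr q => ⟨.inl q, c.cr.write (some coin), c.ctc⟩
  | .flip .ctc q => ⟨.inl q, c.cr, c.ctc.write (some coin)⟩
  | .act s₁ m₁ s₂ m₂ q => ⟨.inl q, (c.cr.write s₁).move m₁, (c.ctc.write s₂).move m₂⟩

/-- One step of `M`. A halted machine stays as it is; a running machine to which no rule applies is
stuck forever, without ever halting. -/
def step (M : Machine) (coin : Bool) (c : Config) : Config :=
  match c.ctl with
  | .inr _ => c
  | .inl q =>
    match M.lookup (q, c.cr.read, c.ctc.read) with
    | some i => exec coin c i
    | none => c

/-- The result of a halted configuration: the output bit and the contents of the CTC register. -/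
def result (c : Config) : Option (Bool × List Bool) :=
  match c.ctl with
  | .inl _ => none
  | .inr b => some (b, c.ctc.str)

noncomputable section

/-- The distribution of the configuration after one step, with a fair coin. -/
def stepDist (M : Machine) (c : Config) : PMF Config :=
  (PMF.uniformOfFintype Bool).map fun coin => step M coin c

/-- The distribution of the configuration after `t` steps. -/
def runDist (M : Machine) (c : Config) : ℕ → PMF Config
  | 0 => PMF.pure c
  | t + 1 => (runDist M c t).bind (stepDist M)

/-- The distribution of the result of `M(x, y)` after `t` steps, where `none` stands for a machine
that is still running. -/
def outcome (M : Machine) (x y : List Bool) (t : ℕ) : PMF (Option (Bool × List Bool)) :=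
  (runDist M (init x y) t).map result

/-- `M(x, y)` halts with probability `1`: for every `ε > 0` there is a time by which it has halted
with probability at least `1 - ε`. -/
def HaltsAlmostSurely (M : Machine) (x y : List Bool) : Prop :=
  ∀ ε : ℝ≥0∞, 0 < ε → ∃ t : ℕ, 1 - ε ≤ ∑' r : Bool × List Bool, outcome M x y t (some r)

/-- The probability that `M(x, y)` ever halts, outputs `b`, and leaves `y'` in the CTC register
(the supremum is the limit, as halted machines stay halted). -/
def finalProb (M : Machine) (x y : List Bool) (b : Bool) (y' : List Bool) : ℝ≥0∞ :=
  ⨆ t : ℕ, outcome M x y t (some (b, y'))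

/-- The probability that `M(x, y)` outputs `b`. -/
def outputProb (M : Machine) (x y : List Bool) (b : Bool) : ℝ≥0∞ :=
  ∑' y' : List Bool, finalProb M x y b y'

/-! ### Deutschian closed timelike curves -/

/-- The stochastic matrix `S_x` that `M` induces on the CTC register: `evol M x y y'` is the
probability that `y` is mapped to `y'`. -/
def evol (M : Machine) (x y y' : List Bool) : ℝ≥0∞ :=
  ∑ b : Bool, finalProb M x y b y'

/-- The distribution `D` on binary strings satisfies the consistency equation `S_x(D) = D`. -/
def IsFixedPoint (M : Machine) (x : List Bool) (D : PMF (List Bool)) : Prop :=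
  ∀ y' : List Bool, ∑' y : List Bool, D y * evol M x y y' = D y'

/-- `M(x, y)` with `y` drawn from `D` outputs `b` with probability at least `2/3`; `D` is
*accepting* for `b = true` and *rejecting* for `b = false`. -/
def LeadsTo (M : Machine) (x : List Bool) (D : PMF (List Bool)) (b : Bool) : Prop :=
  2 / 3 ≤ ∑' y : List Bool, D y * outputProb M x y b

/-- `M` accepts `x`: every fixed-point of `S_x` is accepting. -/
def Accepts (M : Machine) (x : List Bool) : Prop :=
  ∀ D : PMF (List Bool), IsFixedPoint M x D → LeadsTo M x D true

/-- `M` rejects `x`: every fixed-point of `S_x` is rejecting. -/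
def Rejects (M : Machine) (x : List Bool) : Prop :=
  ∀ D : PMF (List Bool), IsFixedPoint M x D → LeadsTo M x D false

/-- `M` is a valid Turing machine with a Deutschian closed timelike curve. -/
structure IsTMCTC (M : Machine) : Prop where
  halts : ∀ x y : List Bool, HaltsAlmostSurely M x y
  exists_fixedPoint : ∀ x : List Bool, ∃ D : PMF (List Bool), IsFixedPoint M x D
  accepts_or_rejects : ∀ x : List Bool, Accepts M x ∨ Rejects M x

/-- The expected length of a string drawn from `D`. -/
def expectedLength (D : PMF (List Bool)) : ℝ≥0∞ :=
  ∑' y : List Bool, D y * (y.length : ℝ≥0∞)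

end

end CTC

/-!
The decision procedure looks for a proof that no fixed-point of small expected length avoids an
output. For a machine `M` that satisfies the promise, with `n = ℓ (M, x)`, exactly one bit `b` is
such that every fixed-point outputs `b` with probability at least `2 / 3`. For this bit no
fixed-point outputs `b` with probability at most `1 / 3`, whereas the promised fixed-point of
expected length at most `n` outputs the other bit with probability at most `1 / 3`. So it is
enough to enumerate the bits `b` for which no fixed-point that satisfies the tightness condition
of Markov's inequality, mass at least `1 - n / L` on the strings of length at most `L`, outputs
`b` with probability at most `1 / 3`.

This non-existence is semi-decidable by compactness. At stage `N` one looks at measures on the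
strings of length at most `N` whose values are multiples of `1 / K`, encoded as lists of at most
`K` strings, and runs `M` for `N` steps only. Probabilities are then numbers of coin sequences
divided by `2 ^ N`, and the condition `CTC.Feasible` that some such measure looks like a
fixed-point that outputs `b` with probability at most `1 / 3` is a finite search, which is
primitive recursive (`CTC.primrecPred_feasible`). The probabilities after `N` steps increase to
the true ones, so they are lower bounds, and every condition is stated as an inequality that
survives this truncation: the map may not increase the mass of any string, and the probability of
output `b` is at most `1 / 3`.

* A fixed-point passes the test at every stage when its probabilities are rounded down
  (`CTC.feasible_of_fixedPoint`).
* If the test can be passed at every stage, a pointwise limit of the measures found has total mass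
  `1` by tightness and satisfies `D S ≤ D`. Since `S` is stochastic both sides have total mass
  `1`, so `D` is a fixed-point (`CTC.exists_stationary_of_approx`,
  `CTC.exists_fixedPoint_of_feasible`).

Hence the stages at which the test fails for `b` exist exactly when `b` is the right answer
(`CTC.exists_not_feasible_iff`), and an unbounded search for such a stage decides.
-/

namespace CTC

/-! ### Primitive recursiveness of the step function -/

/-- `Reg` as a product. -/
def Reg.equivProd : Reg ≃ List Bool × ℕ where
  toFun r := (r.str, r.pos)
  invFun p := ⟨p.1, p.2⟩

/-- `Config` as a product. -/
def Config.equivProd : Config ≃ (ℕ ⊕ Bool) × Reg × Reg where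
  toFun c := (c.ctl, c.cr, c.ctc)
  invFun p := ⟨p.1, p.2.1, p.2.2⟩

instance : Primcodable Reg := Primcodable.ofEquiv _ Reg.equivProd

instance : Primcodable Config := Primcodable.ofEquiv _ Config.equivProd

section Primrec

open _root_.Primrec

theorem primrec_str : Primrec Reg.str :=
  fst.comp (of_equiv (e := Reg.equivProd))

theorem primrec_pos : Primrec Reg.pos :=
  snd.comp (of_equiv (e := Reg.equivProd))

theorem primrec_ctl : Primrec Config.ctl :=
  fst.comp (of_equiv (e := Config.equivProd))

theorem primrec_cr : Primrec Config.cr :=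
  (fst.comp snd).comp (of_equiv (e := Config.equivProd))

theorem primrec_ctc : Primrec Config.ctc :=
  (snd.comp snd).comp (of_equiv (e := Config.equivProd))

variable {α : Type*} [Primcodable α]

theorem primrec_regMk {f : α → List Bool} {g : α → ℕ} (hf : Primrec f) (hg : Primrec g) :
    Primrec fun a => Reg.mk (f a) (g a) :=
  (of_equiv_symm (e := Reg.equivProd)).comp (hf.pair hg)

theorem primrec_configMk {f : α → ℕ ⊕ Bool} {g h : α → Reg} (hf : Primrec f) (hg : Primrec g)
    (hh : Primrec h) : Primrec fun a => Config.mk (f a) (g a) (h a) :=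
  (of_equiv_symm (e := Config.equivProd)).comp (hf.pair (hg.pair hh))

theorem Reg.read_eq (r : Reg) : r.read = if r.pos = 0 then none else r.str[r.pos - 1]? := by
  rcases r with ⟨s, _ | p⟩ <;> simp [Reg.read]

theorem Reg.write_eq (r : Reg) (s : Sym) :
    r.write s = if r.pos = 0 then r else
      ⟨r.str.take (r.pos - 1) ++ s.casesOn [] fun b => b :: r.str.drop r.pos, r.pos⟩ := by
  rcases r with ⟨l, _ | p⟩ <;> rcases s with _ | b <;> simp [Reg.write]

theorem Reg.move_eq (r : Reg) (m : Move) :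
    r.move m = if m = .left then ⟨r.str, r.pos - 1⟩ else if m = .right then
      ⟨r.str, min (r.pos + 1) (r.str.length + 1)⟩ else r := by
  cases m <;> simp [Reg.move]

theorem primrec_read : Primrec Reg.read :=
  (ite (Primrec.eq.comp primrec_pos (const 0)) (const none)
    (list_getElem?.comp primrec_str (pred.comp primrec_pos))).of_eq fun r => (r.read_eq).symm

theorem primrec_write : Primrec₂ Reg.write := by
  have hs : Primrec fun p : Reg × Sym => p.1.str := primrec_str.comp fst
  have hp : Primrec fun p : Reg × Sym => p.1.pos := primrec_pos.comp fst
  refine (ite (Primrec.eq.comp hp (const 0)) fst (primrec_regMk (list_append.comp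
    (list_take.comp (pred.comp hp) hs) (option_casesOn snd (const []) ?_)) hp)).of_eq
      fun p => (p.1.write_eq p.2).symm
  exact list_cons.comp snd ((list_drop.comp hp hs).comp fst)

theorem primrec_move : Primrec₂ Reg.move := by
  have hs : Primrec fun p : Reg × Move => p.1.str := primrec_str.comp fst
  have hp : Primrec fun p : Reg × Move => p.1.pos := primrec_pos.comp fst
  exact (ite (Primrec.eq.comp snd (const _)) (primrec_regMk hs (pred.comp hp))
    (ite (Primrec.eq.comp snd (const _)) (primrec_regMk hs (nat_min.comp (succ.comp hp)
      (succ.comp (list_length.comp hs)))) fst)).of_eq fun p => (p.1.move_eq p.2).symm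

theorem exec_eq (coin : Bool) (c : Config) (i : Instr) :
    exec coin c i = Sum.casesOn (motive := fun _ => Config) (Instr.equivSum i)
      (fun b => ⟨.inr b, c.cr, c.ctc⟩)
      (fun j => Sum.casesOn (motive := fun _ => Config) j
        (fun p => if p.1 = .cr then ⟨.inl p.2, c.cr.write (some coin), c.ctc⟩
          else ⟨.inl p.2, c.cr, c.ctc.write (some coin)⟩)
        (fun p => ⟨.inl p.2.2.2.2, (c.cr.write p.1).move p.2.1,
          (c.ctc.write p.2.2.1).move p.2.2.2.1⟩)) := by
  rcases i with _ | ⟨_ | _, _⟩ | _ <;> simp [exec, Instr.equivSum]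

theorem primrec_exec : Primrec fun p : (Bool × Config) × Instr => exec p.1.1 p.1.2 p.2 := by
  have hflip : Primrec₂ fun (p : ((Bool × Config) × Instr) ×
      ((Register × ℕ) ⊕ (Sym × Move × Sym × Move × ℕ))) (r : Register × ℕ) =>
      if r.1 = .cr then
        (⟨.inl r.2, p.1.1.2.cr.write (some p.1.1.1), p.1.1.2.ctc⟩ : Config)
      else ⟨.inl r.2, p.1.1.2.cr, p.1.1.2.ctc.write (some p.1.1.1)⟩ := by
    have hc := snd.comp (fst.comp (fst.comp (fst (α := ((Bool × Config) × Instr) ×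
      ((Register × ℕ) ⊕ (Sym × Move × Sym × Move × ℕ))) (β := Register × ℕ))))
    have hb := option_some.comp (fst.comp (fst.comp (fst.comp (fst (α := ((Bool × Config) × Instr) ×
      ((Register × ℕ) ⊕ (Sym × Move × Sym × Move × ℕ))) (β := Register × ℕ)))))
    exact ite (Primrec.eq.comp (fst.comp snd) (const _))
      (primrec_configMk (sumInl.comp (snd.comp snd))
        (primrec_write.comp (primrec_cr.comp hc) hb) (primrec_ctc.comp hc))
      (primrec_configMk (sumInl.comp (snd.comp snd)) (primrec_cr.comp hc)
        (primrec_write.comp (primrec_ctc.comp hc) hb))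
  have hact : Primrec₂ fun (p : ((Bool × Config) × Instr) ×
      ((Register × ℕ) ⊕ (Sym × Move × Sym × Move × ℕ))) (r : Sym × Move × Sym × Move × ℕ) =>
      (⟨.inl r.2.2.2.2, (p.1.1.2.cr.write r.1).move r.2.1,
        (p.1.1.2.ctc.write r.2.2.1).move r.2.2.2.1⟩ : Config) := by
    have hc := snd.comp (fst.comp (fst.comp (fst (α := ((Bool × Config) × Instr) ×
      ((Register × ℕ) ⊕ (Sym × Move × Sym × Move × ℕ))) (β := Sym × Move × Sym × Move × ℕ))))
    have h2 := snd.comp (snd (α := ((Bool × Config) × Instr) ×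
      ((Register × ℕ) ⊕ (Sym × Move × Sym × Move × ℕ))) (β := Sym × Move × Sym × Move × ℕ))
    exact primrec_configMk (sumInl.comp (snd.comp (snd.comp (snd.comp h2))))
      (primrec_move.comp (primrec_write.comp (primrec_cr.comp hc) (fst.comp snd)) (fst.comp h2))
      (primrec_move.comp (primrec_write.comp (primrec_ctc.comp hc) (fst.comp (snd.comp h2)))
        (fst.comp (snd.comp (snd.comp h2))))
  have hhalt : Primrec₂ fun (p : (Bool × Config) × Instr) (b : Bool) =>
      (⟨.inr b, p.1.2.cr, p.1.2.ctc⟩ : Config) :=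
    primrec_configMk (sumInr.comp snd) (primrec_cr.comp (snd.comp (fst.comp fst)))
      (primrec_ctc.comp (snd.comp (fst.comp fst)))
  exact (sumCasesOn ((of_equiv (e := Instr.equivSum)).comp snd) hhalt
    (sumCasesOn snd hflip hact).to₂).of_eq fun p => (exec_eq p.1.1 p.1.2 p.2).symm

theorem step_eq (M : Machine) (coin : Bool) (c : Config) :
    step M coin c = Sum.casesOn (motive := fun _ => Config) c.ctl
      (fun q => Option.casesOn (motive := fun _ => Config)
        (@List.lookup _ _ instBEqOfDecidableEq (q, c.cr.read, c.ctc.read) M) c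
        fun i => exec coin c i)
      fun _ => c := by
  -- `step` compares keys with the componentwise `BEq` instance of the product type.
  have : (@List.lookup (ℕ × Sym × Sym) Instr instBEqOfDecidableEq) = List.lookup := by
    congr 1
    exact lawful_beq_subsingleton _ _
  rw [this, step]
  rcases c.ctl with q | _
  · simp only
    rcases M.lookup _ with _ | _ <;> rfl
  · rfl

theorem primrec_step : Primrec fun p : (Machine × Bool) × Config => step p.1.1 p.1.2 p.2 := by
  have hi : Primrec₂ fun (p : ((Machine × Bool) × Config) × ℕ) (i : Instr) =>
      exec p.1.1.2 p.1.2 i :=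
    primrec_exec.comp (pair (pair (snd.comp (fst.comp (fst.comp fst)))
      (snd.comp (fst.comp fst))) snd)
  exact (sumCasesOn (primrec_ctl.comp snd) (option_casesOn (listLookup.comp
    (pair snd (pair (primrec_read.comp (primrec_cr.comp (snd.comp fst)))
      (primrec_read.comp (primrec_ctc.comp (snd.comp fst))))) (fst.comp (fst.comp fst)))
    (snd.comp fst) hi).to₂ (snd.comp fst).to₂).of_eq fun p => (step_eq p.1.1 p.1.2 p.2).symm

theorem primrec_result : Primrec result := by
  refine Primrec.of_eq (sumCasesOn (g := fun _ _ => none)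
    (h := fun (c : Config) b => some (b, c.ctc.str)) primrec_ctl (const none)
    (option_some.comp (pair snd (primrec_str.comp (primrec_ctc.comp fst))))) fun c => ?_
  rw [result]
  rcases c.ctl with _ | _ <;> rfl

theorem primrec_init : Primrec₂ init :=
  primrec_configMk (const _) (primrec_regMk fst (const 1)) (primrec_regMk snd (const 1))

end Primrec

/-! ### The finite search problem -/

/-- The configurations that `M` reaches from `c` after `t` steps, listed once for each of the
`2 ^ t` sequences of coins. -/
def branches (M : Machine) (c : Config) : ℕ → List Config
  | 0 => [c]
  | t + 1 => (branches M c t).flatMap fun d => [step M true d, step M false d]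

/-- The output bits of `M(x, y)` after `t` steps, listed once for each sequence of coins. -/
def outputs (M : Machine) (x : List Bool) (t : ℕ) (y : List Bool) : List (Option Bool) :=
  (branches M (init x y) t).map fun c => (result c).map Prod.fst

/-- The final contents of the CTC register of `M(x, y)` after `t` steps, listed once for each
sequence of coins. -/
def finals (M : Machine) (x : List Bool) (t : ℕ) (y : List Bool) : List (Option (List Bool)) :=
  (branches M (init x y) t).map fun c => (result c).map Prod.snd

/-- All lists of length at most `n` with entries in `s`, possibly with repetitions. -/
def listsUpTo {β : Type*} (s : List β) : ℕ → List (List β)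
  | 0 => [[]]
  | n + 1 => [] :: s.flatMap fun a => (listsUpTo s n).map fun l => a :: l

/-- All binary strings of length at most `N`. -/
def strings (N : ℕ) : List (List Bool) := listsUpTo [true, false] N

/-- The size of the samples of strings at stage `N`. It is `N` times the number of strings, so that
rounding all probabilities to multiples of `1 / sampleSize N` costs a mass of at most `1 / N`. -/
def sampleSize (N : ℕ) : ℕ := N * (strings N).length

/-- The list `w`, read as the measure which gives each string `1 / sampleSize N` times its number of
occurrences, looks at stage `N` like a fixed-point of expected length at most `n` that leads to the
output `b` with probability at most `1 / 3`: by Markov's inequality a mass of at least `1 - n / L`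
lies on the strings of length at most `L`, the map of the first `N` steps of `M` does not increase
the mass of any string, and `b` is output within `N` steps with probability at most `1 / 3`. The
first two conditions leave room for rounding. -/
def IsApproxFixedPoint (M : Machine) (x : List Bool) (n N : ℕ) (b : Bool)
    (w : List (List Bool)) : Prop :=
  (∀ L < N + 1, sampleSize N * L ≤
    L * (w.filter fun y => y.length ≤ L).length + L * (strings N).length + sampleSize N * n) ∧
  (∀ y' ∈ strings N, (w.flatMap (finals M x N)).count (some y') ≤ 2 ^ N * (w.count y' + 1)) ∧
  3 * (w.flatMap (outputs M x N)).count (some b) ≤ sampleSize N * 2 ^ N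

/-- Some sample passes the test of `IsApproxFixedPoint`. -/
def Feasible (M : Machine) (x : List Bool) (n N : ℕ) (b : Bool) : Prop :=
  ∃ w ∈ listsUpTo (strings N) (sampleSize N), IsApproxFixedPoint M x n N b w

theorem mem_listsUpTo {β : Type*} {s : List β} {n : ℕ} {l : List β} :
    l ∈ listsUpTo s n ↔ l.length ≤ n ∧ ∀ a ∈ l, a ∈ s := by
  induction n generalizing l with
  | zero => simp +contextual [listsUpTo]
  | succ n ih => rcases l with _ | ⟨a, l⟩ <;> simp [listsUpTo, ih]; tauto

theorem mem_strings {N : ℕ} {y : List Bool} : y ∈ strings N ↔ y.length ≤ N := by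
  simp [strings, mem_listsUpTo]

section Primrec

open _root_.Primrec

variable {α β : Type*} [Primcodable α] [Primcodable β]

theorem primrec_two_pow : Primrec fun n : ℕ => 2 ^ n :=
  (Primrec₂.unpaired'.1 Nat.Primrec.pow : Primrec₂ fun m n : ℕ => m ^ n).comp (const 2) .id

theorem primrec_count [BEq β] [LawfulBEq β] {f : α → List β} {g : α → β} (hf : Primrec f)
    (hg : Primrec g) : Primrec fun a => (f a).count (g a) := by
  classical
  refine (list_length.comp ((PrimrecRel.listFilter Primrec.eq).comp hf hg)).of_eq fun a => ?_
  rw [List.count, List.countP_eq_length_filter]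
  congr 2
  funext b
  simp [beq_eq_decide]

theorem primrec_listsUpTo : Primrec₂ (listsUpTo (β := β)) := by
  have h : Primrec₂ fun (s : List β) (p : ℕ × List (List β)) =>
      [] :: s.flatMap fun a => p.2.map fun l => a :: l := by
    have h1 : Primrec₂ fun (q : List β × (ℕ × List (List β))) (a : β) =>
        q.2.2.map fun l => a :: l :=
      list_map (snd.comp (snd.comp fst)) (list_cons.comp (snd.comp fst) snd).to₂
    exact list_cons.comp (const []) (list_flatMap fst h1)
  refine (nat_rec (const [[]]) h).of_eq fun s n => ?_
  induction n with
  | zero => rfl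
  | succ n ih => simp only [listsUpTo, ih]

theorem primrec_strings : Primrec strings :=
  primrec_listsUpTo.comp (const _) .id

theorem primrec_sampleSize : Primrec sampleSize :=
  nat_mul.comp .id (list_length.comp primrec_strings)

theorem primrec_branches : Primrec₂ fun (p : Machine × Config) (t : ℕ) => branches p.1 p.2 t := by
  have h : Primrec₂ fun (p : Machine × Config) (q : ℕ × List Config) =>
      q.2.flatMap fun d => [step p.1 true d, step p.1 false d] := by
    have h1 (b : Bool) : Primrec fun (r : ((Machine × Config) × ℕ × List Config) × Config) =>
        step r.1.1.1 b r.2 :=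
      primrec_step.comp (pair (pair (fst.comp (fst.comp fst)) (const b)) snd)
    exact list_flatMap (snd.comp snd)
      (list_cons.comp (h1 true) (list_cons.comp (h1 false) (const []))).to₂
  refine (nat_rec (list_cons.comp snd (const [])) h).of_eq fun p t => ?_
  induction t with
  | zero => rfl
  | succ t ih => simp only [branches, ih]

theorem primrec_outputs : Primrec fun p : (Machine × List Bool) × ℕ × List Bool =>
    outputs p.1.1 p.1.2 p.2.1 p.2.2 := by
  have h : Primrec₂ fun (_ : (Machine × List Bool) × ℕ × List Bool) (c : Config) =>
      (result c).map Prod.fst :=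
    option_map (primrec_result.comp snd) (fst.comp snd).to₂
  exact list_map (primrec_branches.comp (pair (fst.comp fst)
    (primrec_init.comp (snd.comp fst) (snd.comp snd))) (fst.comp snd)) h

theorem primrec_finals : Primrec fun p : (Machine × List Bool) × ℕ × List Bool =>
    finals p.1.1 p.1.2 p.2.1 p.2.2 := by
  have h : Primrec₂ fun (_ : (Machine × List Bool) × ℕ × List Bool) (c : Config) =>
      (result c).map Prod.snd :=
    option_map (primrec_result.comp snd) (snd.comp snd).to₂
  exact list_map (primrec_branches.comp (pair (fst.comp fst)
    (primrec_init.comp (snd.comp fst) (snd.comp snd))) (fst.comp snd)) h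

theorem primrecRel_isApproxFixedPoint :
    PrimrecRel fun (w : List (List Bool)) (p : (Machine × List Bool) × ℕ × ℕ × Bool) =>
      IsApproxFixedPoint p.1.1 p.1.2 p.2.1 p.2.2.1 p.2.2.2 w := by
  let Q := List (List Bool) × (Machine × List Bool) × ℕ × ℕ × Bool
  have hw : Primrec fun q : Q => q.1 := fst
  have hn : Primrec fun q : Q => q.2.2.1 := fst.comp (snd.comp snd)
  have hN : Primrec fun q : Q => q.2.2.2.1 := fst.comp (snd.comp (snd.comp snd))
  have hb : Primrec fun q : Q => q.2.2.2.2 := snd.comp (snd.comp (snd.comp snd))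
  have hK : Primrec fun q : Q => sampleSize q.2.2.2.1 := primrec_sampleSize.comp hN
  have hmass : PrimrecRel fun (L : ℕ) (q : Q) => sampleSize q.2.2.2.1 * L ≤
      L * (q.1.filter fun y => y.length ≤ L).length + L * (strings q.2.2.2.1).length +
        sampleSize q.2.2.2.1 * q.2.2.1 := by
    have hle : PrimrecRel fun (y : List Bool) (L : ℕ) => y.length ≤ L :=
      nat_le.comp (list_length.comp fst) snd
    exact nat_le.comp (nat_mul.comp (hK.comp snd) fst)
      (nat_add.comp (nat_add.comp
        (nat_mul.comp fst (list_length.comp (hle.listFilter.comp (hw.comp snd) fst)))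
        (nat_mul.comp fst (list_length.comp (primrec_strings.comp (hN.comp snd)))))
        (nat_mul.comp (hK.comp snd) (hn.comp snd)))
  have hfix : PrimrecRel fun (y' : List Bool) (q : Q) =>
      (q.1.flatMap (finals q.2.1.1 q.2.1.2 q.2.2.2.1)).count (some y') ≤
        2 ^ q.2.2.2.1 * (q.1.count y' + 1) := by
    have hf : Primrec fun q : Q => q.1.flatMap (finals q.2.1.1 q.2.1.2 q.2.2.2.1) :=
      list_flatMap hw (primrec_finals.comp
        (pair (fst.comp (snd.comp fst)) (pair (hN.comp fst) snd))).to₂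
    exact nat_le.comp (primrec_count (hf.comp snd) (option_some.comp fst))
      (nat_mul.comp (primrec_two_pow.comp (hN.comp snd))
        (succ.comp (primrec_count (hw.comp snd) fst)))
  have hout : PrimrecPred fun q : Q =>
      3 * (q.1.flatMap (outputs q.2.1.1 q.2.1.2 q.2.2.2.1)).count (some q.2.2.2.2) ≤
        sampleSize q.2.2.2.1 * 2 ^ q.2.2.2.1 := by
    have hf : Primrec fun q : Q => q.1.flatMap (outputs q.2.1.1 q.2.1.2 q.2.2.2.1) :=
      list_flatMap hw (primrec_outputs.comp
        (pair (fst.comp (snd.comp fst)) (pair (hN.comp fst) snd))).to₂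
    exact nat_le.comp (nat_mul.comp (const 3) (primrec_count hf (option_some.comp hb)))
      (nat_mul.comp hK (primrec_two_pow.comp hN))
  have hmass' := hmass.forall_mem_list
  exact ((hmass'.comp (list_range.comp (succ.comp hN)) .id).of_eq (by simp)).and
    ((hfix.forall_mem_list.comp (primrec_strings.comp hN) .id).and hout)

theorem primrecPred_feasible :
    PrimrecPred fun p : (Machine × List Bool) × ℕ × ℕ × Bool =>
      Feasible p.1.1 p.1.2 p.2.1 p.2.2.1 p.2.2.2 :=
  have hN : Primrec fun p : (Machine × List Bool) × ℕ × ℕ × Bool => p.2.2.1 :=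
    fst.comp (snd.comp snd)
  primrecRel_isApproxFixedPoint.exists_mem_list.comp
    (primrec_listsUpTo.comp (primrec_strings.comp hN) (primrec_sampleSize.comp hN)) .id

end Primrec

/-! ### Probabilities as counts over coin sequences -/

section Probability

theorem tsum_bind_mul {α β : Type*} (p : PMF α) (f : α → PMF β) (g : β → ℝ≥0∞) :
    ∑' b, p.bind f b * g b = ∑' a, p a * ∑' b, f a b * g b := by
  simp_rw [PMF.bind_apply, ← ENNReal.tsum_mul_right, ← ENNReal.tsum_mul_left]
  rw [ENNReal.tsum_comm]
  simp_rw [mul_assoc]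

theorem tsum_pure_mul {α : Type*} (a : α) (g : α → ℝ≥0∞) : ∑' b, PMF.pure a b * g b = g a := by
  rw [tsum_eq_single a (by simp +contextual [PMF.pure_apply])]
  simp

theorem tsum_map_mul {α β : Type*} (p : PMF α) (f : α → β) (g : β → ℝ≥0∞) :
    ∑' b, p.map f b * g b = ∑' a, p a * g (f a) := by
  simp_rw [PMF.map, tsum_bind_mul, Function.comp_apply, tsum_pure_mul]

variable (M : Machine) (x y : List Bool)

theorem tsum_stepDist_mul (c : Config) (g : Config → ℝ≥0∞) :
    ∑' d, stepDist M c d * g d = (g (step M true c) + g (step M false c)) / 2 := by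
  rw [stepDist, tsum_map_mul, tsum_fintype]
  simp [ENNReal.div_eq_inv_mul, mul_add]

theorem sum_map_flatMap {α β : Type*} (l : List α) (f : α → List β) (g : β → ℝ≥0∞) :
    ((l.flatMap f).map g).sum = (l.map fun a => ((f a).map g).sum).sum := by
  induction l with
  | nil => rfl
  | cons a l ih => simp [ih]

/-- Expectations after `t` steps are averages over the `2 ^ t` coin sequences. -/
theorem tsum_runDist_mul (c : Config) (t : ℕ) (g : Config → ℝ≥0∞) :
    ∑' d, runDist M c t d * g d = ((branches M c t).map g).sum / 2 ^ t := by
  induction t generalizing g with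
  | zero => simp [runDist, branches]
  | succ t ih =>
    rw [runDist, tsum_bind_mul, ih, branches, sum_map_flatMap]
    simp_rw [tsum_stepDist_mul, div_eq_mul_inv]
    rw [List.sum_map_mul_right, pow_succ, ENNReal.mul_inv (by simp) (by simp), mul_assoc,
      mul_comm (2⁻¹ : ℝ≥0∞)]
    simp

theorem sum_map_indicator {α : Type*} [DecidableEq α] [BEq α] [LawfulBEq α] (l : List α) (a : α) :
    (l.map fun b => if b = a then (1 : ℝ≥0∞) else 0).sum = l.count a := by
  induction l with
  | nil => simp
  | cons b l ih => by_cases h : b = a <;> simp [h, ih, add_comm]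

theorem tsum_runDist_indicator {β : Type*} [DecidableEq β] [BEq β] [LawfulBEq β] (c : Config)
    (t : ℕ) (f : Config → β) (a : β) : ∑' d, runDist M c t d * (if f d = a then 1 else 0) =
      ((branches M c t).map f).count a / 2 ^ t := by
  rw [tsum_runDist_mul, ← sum_map_indicator, List.map_map]
  rfl

theorem outcome_apply (t : ℕ) (o : Option (Bool × List Bool)) :
    outcome M x y t o = ∑' d, runDist M (init x y) t d * (if result d = o then 1 else 0) := by
  rw [outcome, ← tsum_map_mul _ result fun o' => if o' = o then (1 : ℝ≥0∞) else 0,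
    tsum_eq_single o (by simp +contextual)]
  simp

/-- The probability that the bit `b` has been output after `t` steps. -/
noncomputable def outputBy (t : ℕ) (b : Bool) : ℝ≥0∞ :=
  ∑' y' : List Bool, outcome M x y t (some (b, y'))

/-- The probability that the machine has halted with `y'` in the CTC register after `t` steps. -/
noncomputable def evolBy (t : ℕ) (y' : List Bool) : ℝ≥0∞ :=
  ∑ b : Bool, outcome M x y t (some (b, y'))

theorem outputBy_eq_count (t : ℕ) (b : Bool) :
    outputBy M x y t b = (outputs M x t y).count (some b) / 2 ^ t := by
  rw [outputBy, outputs]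
  simp_rw [outcome_apply]
  rw [ENNReal.tsum_comm, ← tsum_runDist_indicator]
  refine tsum_congr fun d => ?_
  rw [ENNReal.tsum_mul_left]
  congr 1
  rcases result d with _ | ⟨b', y'⟩
  · simp
  · by_cases h : b' = b
    · simp [h]
    · simp [h]

theorem evolBy_eq_count (t : ℕ) (y' : List Bool) :
    evolBy M x y t y' = (finals M x t y).count (some y') / 2 ^ t := by
  rw [evolBy, finals]
  simp_rw [outcome_apply]
  rw [← tsum_fintype (L := .unconditional _), ENNReal.tsum_comm, ← tsum_runDist_indicator]
  refine tsum_congr fun d => ?_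
  rw [ENNReal.tsum_mul_left]
  congr 1
  rcases result d with _ | ⟨b, z⟩
  · simp
  · by_cases h : z = y' <;> simp [h]

theorem result_step {c : Config} {r : Bool × List Bool} (h : result c = some r) (coin : Bool) :
    step M coin c = c := by
  rcases c with ⟨_ | _, _, _⟩
  · simp [result] at h
  · rfl

/-- Halted machines stay halted. -/
theorem outcome_mono (r : Bool × List Bool) : Monotone fun t => outcome M x y t (some r) := by
  refine monotone_nat_of_le_succ fun t => ?_
  simp_rw [outcome_apply, runDist, tsum_bind_mul]
  gcongr with d
  split_ifs with h
  · rw [tsum_stepDist_mul, result_step M h, result_step M h, if_pos h, one_add_one_eq_two,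
      ENNReal.div_self (by simp) (by simp)]
  · simp

theorem evolBy_mono (y' : List Bool) : Monotone fun t => evolBy M x y t y' :=
  fun _ _ h => Finset.sum_le_sum fun b _ => outcome_mono M x y (b, y') h

theorem outputBy_mono (b : Bool) : Monotone fun t => outputBy M x y t b :=
  fun _ _ h => ENNReal.tsum_le_tsum fun y' => outcome_mono M x y (b, y') h

theorem iSup_evolBy (y' : List Bool) : ⨆ t, evolBy M x y t y' = evol M x y y' :=
  (ENNReal.finsetSum_iSup_of_monotone fun b => outcome_mono M x y (b, y')).symm

theorem tsum_iSup_of_monotone {α : Type*} {f : α → ℕ → ℝ≥0∞} (h : ∀ a, Monotone (f a)) :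
    ∑' a, ⨆ t, f a t = ⨆ t, ∑' a, f a t := by
  simp_rw [ENNReal.tsum_eq_iSup_sum, ENNReal.finsetSum_iSup_of_monotone h]
  exact iSup_comm

theorem iSup_outputBy (b : Bool) : ⨆ t, outputBy M x y t b = outputProb M x y b :=
  (tsum_iSup_of_monotone fun y' => outcome_mono M x y (b, y')).symm

theorem tsum_finalProb_eq_iSup : ∑' r : Bool × List Bool, finalProb M x y r.1 r.2 =
    ⨆ t, ∑' r : Bool × List Bool, outcome M x y t (some r) :=
  tsum_iSup_of_monotone fun r => outcome_mono M x y r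

theorem tsum_finalProb_le_one : ∑' r : Bool × List Bool, finalProb M x y r.1 r.2 ≤ 1 := by
  rw [tsum_finalProb_eq_iSup]
  refine iSup_le fun t => ?_
  rw [← (outcome M x y t).tsum_coe]
  exact ENNReal.tsum_comp_le_tsum_of_injective (Option.some_injective _) _

theorem tsum_finalProb_eq_one (h : HaltsAlmostSurely M x y) :
    ∑' r : Bool × List Bool, finalProb M x y r.1 r.2 = 1 := by
  refine le_antisymm (tsum_finalProb_le_one M x y) ?_
  rw [tsum_finalProb_eq_iSup]
  refine ENNReal.le_of_forall_pos_le_add fun ε hε _ => ?_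
  obtain ⟨t, ht⟩ := h ε (by simpa using hε)
  exact tsub_le_iff_right.1 (ht.trans (le_iSup (fun t => ∑' r, outcome M x y t (some r)) t))

theorem tsum_evol (h : HaltsAlmostSurely M x y) : ∑' y', evol M x y y' = 1 := by
  rw [← tsum_finalProb_eq_one M x y h, ENNReal.tsum_prod, ENNReal.tsum_comm]
  simp [evol]

theorem outputProb_add_le_one :
    outputProb M x y true + outputProb M x y false ≤ 1 := by
  refine le_trans (le_of_eq ?_) (tsum_finalProb_le_one M x y)
  rw [ENNReal.tsum_prod]
  simp [outputProb]

end Probability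

/-! ### Limits of approximate fixed-points -/

open Filter Topology in
/-- Let `S` be a stochastic matrix and `q` a function, both given as increasing limits of `S t` and
`q t`. If measures `p N` of total mass at most `1` are tight, are asymptotically not increased by
any `S t` at any point, and asymptotically give each `q t` expectation at most `c`, then `S` has a
stationary distribution under which `q` has expectation at most `c`.

It is a pointwise limit of the `p N` along an ultrafilter. Tightness makes it a probability
distribution, and an inequality `D S ≤ D` between distributions is an equality. -/
theorem exists_stationary_of_approx {α : Type*} {S : ℕ → α → α → ℝ≥0∞} {q : ℕ → α → ℝ≥0∞}
    (hS : ∀ a b, Monotone fun t => S t a b) (hq : ∀ a, Monotone fun t => q t a)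
    (hrow : ∀ a, ∑' b, ⨆ t, S t a b = 1) (hfin : ∀ t a, q t a ≠ ∞)
    {p : ℕ → α → ℝ≥0∞} {c : ℝ≥0∞} {B : ℕ → Finset α} {δ ε : ℕ → ℝ≥0∞}
    (hδ : Tendsto δ atTop (𝓝 0)) (hε : Tendsto ε atTop (𝓝 0))
    (hmass : ∀ F : Finset α, ∀ᶠ N in atTop, ∑ a ∈ F, p N a ≤ 1)
    (htight : ∀ L, ∀ᶠ N in atTop, 1 ≤ ∑ a ∈ B L, p N a + δ N + ε L)
    (hfix : ∀ (b : α) (F : Finset α) (t : ℕ),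
      ∀ᶠ N in atTop, ∑ a ∈ F, p N a * S t a b ≤ p N b + δ N)
    (hout : ∀ (F : Finset α) (t : ℕ), ∀ᶠ N in atTop, ∑ a ∈ F, p N a * q t a ≤ c) :
    ∃ D : PMF α, (∀ b, ∑' a, D a * ⨆ t, S t a b = D b) ∧ ∑' a, D a * ⨆ t, q t a ≤ c := by
  let U : Ultrafilter ℕ := hyperfilter ℕ
  have hU : (U : Filter ℕ) ≤ atTop := Nat.hyperfilter_le_atTop
  let D : α → ℝ≥0∞ := fun a => (U.map fun N => p N a).lim
  have hD (a : α) : Tendsto (fun N => p N a) U (𝓝 (D a)) := (U.map fun N => p N a).le_nhds_lim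
  have hSfin (t : ℕ) (a b : α) : S t a b ≠ ∞ := by
    refine ne_top_of_le_ne_top ENNReal.one_ne_top ?_
    rw [← hrow a]
    exact (le_iSup (fun t => S t a b) t).trans (ENNReal.le_tsum b)
  have hδU : Tendsto δ U (𝓝 0) := hδ.mono_left hU
  have hle (F : Finset α) : ∑ a ∈ F, D a ≤ 1 :=
    le_of_tendsto (tendsto_finsetSum F fun a _ => hD a) ((hmass F).filter_mono hU)
  have hsum : ∑' a, D a = 1 := by
    refine le_antisymm ?_ ?_
    · rw [ENNReal.tsum_eq_iSup_sum]
      exact iSup_le hle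
    · have h (L : ℕ) : 1 ≤ ∑' a, D a + ε L := by
        have h1 : 1 ≤ ∑ a ∈ B L, D a + 0 + ε L :=
          ge_of_tendsto (((tendsto_finsetSum _ fun a _ => hD a).add hδU).add tendsto_const_nhds)
            ((htight L).filter_mono hU)
        rw [add_zero] at h1
        exact h1.trans (by gcongr; exact ENNReal.sum_le_tsum _)
      simpa using ge_of_tendsto (tendsto_const_nhds.add hε) (Eventually.of_forall h)
  have hDfin (a : α) : D a ≠ ∞ :=
    ne_top_of_le_ne_top ENNReal.one_ne_top (hsum ▸ ENNReal.le_tsum a)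
  -- First `N → ∞` along the ultrafilter, for a finite set of points and a fixed `t`, then `t → ∞`.
  have hlim (F : Finset α) (f : ℕ → α → ℝ≥0∞) (hf : ∀ a, Monotone fun t => f t a) (r : ℝ≥0∞)
      (h : ∀ t, ∑ a ∈ F, D a * f t a ≤ r) : ∑ a ∈ F, D a * ⨆ t, f t a ≤ r :=
    le_of_tendsto (tendsto_finsetSum F fun a _ => ENNReal.Tendsto.const_mul
      (tendsto_atTop_iSup (hf a)) (Or.inr (hDfin a))) (Eventually.of_forall h)
  have hsub (b : α) : ∑' a, D a * ⨆ t, S t a b ≤ D b := by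
    rw [ENNReal.tsum_eq_iSup_sum]
    refine iSup_le fun F => hlim F _ (fun a => hS a b) _ fun t => ?_
    have h := le_of_tendsto_of_tendsto (tendsto_finsetSum F fun a _ =>
      ENNReal.Tendsto.mul_const (hD a) (Or.inr (hSfin t a b))) ((hD b).add hδU)
      ((hfix b F t).filter_mono hU)
    rwa [add_zero] at h
  refine ⟨⟨D, hsum ▸ ENNReal.summable.hasSum⟩, fun b => ?_, ?_⟩
  · have htot : ∑' b, ∑' a, D a * ⨆ t, S t a b = 1 := by
      rw [ENNReal.tsum_comm]
      simp_rw [ENNReal.tsum_mul_left, hrow, mul_one]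
      exact hsum
    by_contra hne
    have := ENNReal.tsum_lt_tsum (by rw [htot]; exact ENNReal.one_ne_top) hsub
      (lt_of_le_of_ne (hsub b) hne)
    rw [htot, hsum] at this
    exact this.false
  · rw [ENNReal.tsum_eq_iSup_sum]
    exact iSup_le fun F => hlim F q hq _ fun t => le_of_tendsto (tendsto_finsetSum F fun a _ =>
      ENNReal.Tendsto.mul_const (hD a) (Or.inr (hfin t a))) ((hout F t).filter_mono hU)

/-! ### Samples and distributions -/

theorem tsum_count_mul {α : Type*} [BEq α] [LawfulBEq α] (w : List α) (g : α → ℝ≥0∞) :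
    ∑' a, (w.count a : ℝ≥0∞) * g a = (w.map g).sum := by
  induction w with
  | nil => simp
  | cons b w ih =>
    simp_rw [List.count_cons, Nat.cast_add, add_mul, List.map_cons, List.sum_cons]
    rw [ENNReal.tsum_add, ih, add_comm, tsum_eq_single b fun c hc => by simp [hc.symm]]
    simp

theorem count_flatMap_eq_tsum {α β : Type*} [BEq α] [LawfulBEq α] [BEq β] [LawfulBEq β] (w : List α)
    (f : α → List β) (o : β) :
    ((w.flatMap f).count o : ℝ≥0∞) = ∑' a, (w.count a : ℝ≥0∞) * (f a).count o := by
  rw [tsum_count_mul, List.count_flatMap]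
  induction w with
  | nil => simp
  | cons b w ih => simp [ih]

theorem length_eq_tsum {α : Type*} [BEq α] [LawfulBEq α] (w : List α) :
    (w.length : ℝ≥0∞) = ∑' a, (w.count a : ℝ≥0∞) := by
  simpa using (tsum_count_mul w fun _ => 1).symm

theorem length_filter_eq_sum (w : List (List Bool)) (L : ℕ) :
    ((w.filter fun y => y.length ≤ L).length : ℝ≥0∞) =
      ∑ y ∈ (strings L).toFinset, (w.count y : ℝ≥0∞) := by
  rw [length_eq_tsum, tsum_eq_sum (s := (strings L).toFinset)]
  · refine Finset.sum_congr rfl fun y hy => ?_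
    rw [List.mem_toFinset, mem_strings] at hy
    rw [List.count_filter (by simpa using hy)]
  · intro y hy
    rw [List.mem_toFinset, mem_strings] at hy
    simp [List.count_eq_zero, hy]

variable {M : Machine} {x : List Bool} {n N : ℕ} {b : Bool} {w : List (List Bool)}

theorem strings_length_pos (N : ℕ) : 0 < (strings N).length :=
  List.length_pos_of_mem (mem_strings.2 (Nat.zero_le N) : [] ∈ strings N)

theorem tsum_count_mul_evolBy (y' : List Bool) :
    ∑' y, (w.count y : ℝ≥0∞) * evolBy M x y N y' =
      (w.flatMap (finals M x N)).count (some y') / 2 ^ N := by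
  simp_rw [evolBy_eq_count, count_flatMap_eq_tsum, div_eq_mul_inv, ← mul_assoc,
    ENNReal.tsum_mul_right]

theorem tsum_count_mul_outputBy :
    ∑' y, (w.count y : ℝ≥0∞) * outputBy M x y N b =
      (w.flatMap (outputs M x N)).count (some b) / 2 ^ N := by
  simp_rw [outputBy_eq_count, count_flatMap_eq_tsum, div_eq_mul_inv, ← mul_assoc,
    ENNReal.tsum_mul_right]

open Filter Topology in
/-- If the search succeeds at every stage, the samples have a limit which is a fixed-point. -/
theorem exists_fixedPoint_of_feasible (hM : ∀ y, HaltsAlmostSurely M x y)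
    (h : ∀ N, Feasible M x n N b) :
    ∃ D, IsFixedPoint M x D ∧ ∑' y, D y * outputProb M x y b ≤ 1 / 3 := by
  choose w hw hmass hfix hout using h
  have hK (N : ℕ) (hN : 0 < N) : (sampleSize N : ℝ≥0∞) ≠ 0 := by
    exact Nat.cast_ne_zero.2 (Nat.mul_pos hN (strings_length_pos N)).ne'
  have hfin (N : ℕ) : (sampleSize N : ℝ≥0∞) ≠ ∞ := ENNReal.natCast_ne_top _
  have hinv (N : ℕ) (hN : 0 < N) : (sampleSize N : ℝ≥0∞)⁻¹ ≤ (N : ℝ≥0∞)⁻¹ := by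
    refine ENNReal.inv_le_inv.2 (Nat.cast_le.2 ?_)
    exact Nat.le_mul_of_pos_right N (strings_length_pos N)
  have key := exists_stationary_of_approx (S := fun t y y' => evolBy M x y t y')
    (q := fun t y => outputBy M x y t b)
    (p := fun N y => ((w N).count y : ℝ≥0∞) * (sampleSize N : ℝ≥0∞)⁻¹) (c := 1 / 3)
    (B := fun L => (strings (L + 1)).toFinset) (δ := fun N => (N : ℝ≥0∞)⁻¹)
    (ε := fun L => n * ((L + 1 : ℕ) : ℝ≥0∞)⁻¹)
    (fun y y' => evolBy_mono M x y y') (fun y => outputBy_mono M x y b)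
    (fun y => by simp_rw [iSup_evolBy]; exact tsum_evol M x y (hM y))
    (fun t y => by
      rw [outputBy_eq_count]
      exact ENNReal.div_ne_top (ENNReal.natCast_ne_top _) (by simp))
    ENNReal.tendsto_inv_nat_nhds_zero ?_ ?_ ?_ ?_ ?_
  · obtain ⟨D, h1, h2⟩ := key
    simp_rw [iSup_evolBy] at h1
    simp_rw [iSup_outputBy] at h2
    exact ⟨D, h1, h2⟩
  · simpa using ENNReal.Tendsto.const_mul
      (ENNReal.tendsto_inv_nat_nhds_zero.comp (tendsto_add_atTop_nat 1))
      (Or.inr (ENNReal.natCast_ne_top n))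
  · intro F
    filter_upwards [eventually_gt_atTop 0] with N hN
    refine (ENNReal.sum_le_tsum F).trans ?_
    rw [ENNReal.tsum_mul_right, ← length_eq_tsum, ← div_eq_mul_inv]
    exact ENNReal.div_le_of_le_mul (by simpa using (mem_listsUpTo.1 (hw N)).1)
  · intro L
    filter_upwards [eventually_gt_atTop L] with N hN
    have h1 := hmass N (L + 1) (by omega)
    have h2 : (sampleSize N : ℝ≥0∞) * (sampleSize N : ℝ≥0∞)⁻¹ = 1 :=
      ENNReal.mul_inv_cancel (hK N (by omega)) (hfin N)
    have h3 : ((L + 1 : ℕ) : ℝ≥0∞) * ((L + 1 : ℕ) : ℝ≥0∞)⁻¹ = 1 :=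
      ENNReal.mul_inv_cancel (by simp) (by simp)
    have h4 : ((strings N).length : ℝ≥0∞) * (sampleSize N : ℝ≥0∞)⁻¹ = (N : ℝ≥0∞)⁻¹ := by
      have : ((strings N).length : ℝ≥0∞) ≠ 0 := by simpa using (strings_length_pos N).ne'
      rw [sampleSize, Nat.cast_mul, ENNReal.mul_inv (by simp) (by simp),
        mul_left_comm, ENNReal.mul_inv_cancel this (by simp), mul_one]
    rw [← Finset.sum_mul, ← length_filter_eq_sum, ← h4]
    have h5 := @Nat.cast_le ℝ≥0∞ _ _ _ _ |>.2 h1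
    rw [Nat.cast_add, Nat.cast_add, Nat.cast_mul, Nat.cast_mul, Nat.cast_mul, Nat.cast_mul] at h5
    generalize ((L + 1 : ℕ) : ℝ≥0∞) = l at *
    generalize (sampleSize N : ℝ≥0∞) = K at *
    generalize (((w N).filter fun y => y.length ≤ L + 1).length : ℝ≥0∞) = m at *
    calc (1 : ℝ≥0∞) = K * K⁻¹ * (l * l⁻¹) := by rw [h2, h3, one_mul]
      _ = K * l * (K⁻¹ * l⁻¹) := by ring
      _ ≤ _ := mul_le_mul_left h5 _
      _ = m * K⁻¹ * (l * l⁻¹) + (strings N).length * K⁻¹ * (l * l⁻¹) + n * l⁻¹ * (K * K⁻¹) := by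
        ring
      _ = _ := by rw [h2, h3, mul_one, mul_one, mul_one]
  · intro y' F t
    filter_upwards [eventually_ge_atTop t, eventually_ge_atTop y'.length, eventually_gt_atTop 0]
      with N ht hy hN
    have h1 : ((w N).flatMap (finals M x N)).count (some y') / (2 : ℝ≥0∞) ^ N ≤
        (w N).count y' + 1 := by
      refine ENNReal.div_le_of_le_mul' ?_
      exact_mod_cast hfix N y' (mem_strings.2 hy)
    calc ∑ y ∈ F, ((w N).count y : ℝ≥0∞) * (sampleSize N : ℝ≥0∞)⁻¹ * evolBy M x y t y'
        ≤ ∑' y, ((w N).count y : ℝ≥0∞) * (sampleSize N : ℝ≥0∞)⁻¹ * evolBy M x y t y' :=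
          ENNReal.sum_le_tsum F
      _ ≤ ∑' y, ((w N).count y : ℝ≥0∞) * (sampleSize N : ℝ≥0∞)⁻¹ * evolBy M x y N y' := by
          gcongr with y
          exact evolBy_mono M x y y' ht
      _ = (∑' y, ((w N).count y : ℝ≥0∞) * evolBy M x y N y') * (sampleSize N : ℝ≥0∞)⁻¹ := by
          simp_rw [mul_right_comm _ (sampleSize N : ℝ≥0∞)⁻¹, ENNReal.tsum_mul_right]
      _ ≤ ((w N).count y' + 1) * (sampleSize N : ℝ≥0∞)⁻¹ := by
          rw [tsum_count_mul_evolBy]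
          gcongr
      _ ≤ (w N).count y' * (sampleSize N : ℝ≥0∞)⁻¹ + (N : ℝ≥0∞)⁻¹ := by
          rw [add_mul, one_mul]
          exact add_le_add_right (hinv N hN) _
  · intro F t
    filter_upwards [eventually_ge_atTop t, eventually_gt_atTop 0] with N ht hN
    have h1 : ((w N).flatMap (outputs M x N)).count (some b) / (2 : ℝ≥0∞) ^ N ≤
        1 / 3 * sampleSize N := by
      refine ENNReal.div_le_of_le_mul ?_
      rw [one_div, mul_assoc, ← ENNReal.div_eq_inv_mul,
        ENNReal.le_div_iff_mul_le (by simp) (by simp), mul_comm]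
      exact_mod_cast hout N
    calc ∑ y ∈ F, ((w N).count y : ℝ≥0∞) * (sampleSize N : ℝ≥0∞)⁻¹ * outputBy M x y t b
        ≤ ∑' y, ((w N).count y : ℝ≥0∞) * (sampleSize N : ℝ≥0∞)⁻¹ * outputBy M x y t b :=
          ENNReal.sum_le_tsum F
      _ ≤ ∑' y, ((w N).count y : ℝ≥0∞) * (sampleSize N : ℝ≥0∞)⁻¹ * outputBy M x y N b := by
          gcongr with y
          exact outputBy_mono M x y b ht
      _ = (∑' y, ((w N).count y : ℝ≥0∞) * outputBy M x y N b) * (sampleSize N : ℝ≥0∞)⁻¹ := by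
          simp_rw [mul_right_comm _ (sampleSize N : ℝ≥0∞)⁻¹, ENNReal.tsum_mul_right]
      _ ≤ 1 / 3 * sampleSize N * (sampleSize N : ℝ≥0∞)⁻¹ := by
          rw [tsum_count_mul_outputBy]
          gcongr
      _ = 1 / 3 := by
          rw [mul_assoc, ENNReal.mul_inv_cancel (hK N hN) (hfin N), mul_one]

/-- With a fixed-point of small expected length the search succeeds at every stage: the sample is
the distribution with all probabilities rounded down to multiples of `1 / sampleSize N`. -/
theorem feasible_of_fixedPoint {D : PMF (List Bool)} (hD : IsFixedPoint M x D)
    (hlen : expectedLength D ≤ n) (hout : ∑' y, D y * outputProb M x y b ≤ 1 / 3) (N : ℕ) :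
    Feasible M x n N b := by
  let K := sampleSize N
  let k (y : List Bool) : ℕ := ⌊(K * D y).toReal⌋₊
  let w : List (List Bool) := (strings N).dedup.flatMap fun y => List.replicate (k y) y
  have hfin (y : List Bool) : (K : ℝ≥0∞) * D y ≠ ∞ :=
    ENNReal.mul_ne_top (ENNReal.natCast_ne_top K) (D.apply_ne_top y)
  have hk (y : List Bool) : (k y : ℝ≥0∞) ≤ K * D y := by
    rw [← ENNReal.ofReal_toReal (hfin y), ← ENNReal.ofReal_natCast]
    exact ENNReal.ofReal_le_ofReal (Nat.floor_le ENNReal.toReal_nonneg)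
  have hk' (y : List Bool) : (K : ℝ≥0∞) * D y ≤ k y + 1 := by
    rw [← ENNReal.ofReal_toReal (hfin y)]
    refine (ENNReal.ofReal_le_ofReal (Nat.lt_floor_add_one _).le).trans_eq ?_
    rw [ENNReal.ofReal_add (Nat.cast_nonneg _) zero_le_one, ENNReal.ofReal_natCast,
      ENNReal.ofReal_one]
  have hcount (y : List Bool) (hy : y.length ≤ N) : w.count y = k y := by
    have h : ((List.count y ∘ fun z => List.replicate (k z) z) : List Bool → ℕ) =
        fun z => if z = y then k y else 0 := by
      funext z
      by_cases hz : z = y <;> simp [List.count_replicate, hz]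
    have hmem : y ∈ (strings N).dedup := List.mem_dedup.2 (mem_strings.2 hy)
    rw [List.count_flatMap, h, List.sum_map_eq_nsmul_single y _ fun _ hz _ => if_neg hz,
      @List.count_eq_one_of_mem _ instBEqOfDecidableEq _ _ _ (List.nodup_dedup _) hmem, if_pos rfl,
      one_smul]
  have hcount' (y : List Bool) : (w.count y : ℝ≥0∞) ≤ K * D y := by
    by_cases hy : y.length ≤ N
    · rw [hcount y hy]
      exact hk y
    · rw [List.count_eq_zero_of_not_mem]
      · simp
      · intro h
        obtain ⟨z, hz, hy'⟩ := List.mem_flatMap.1 h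
        rw [List.mem_dedup, mem_strings] at hz
        exact hy ((List.eq_of_mem_replicate hy') ▸ hz)
  refine ⟨w, mem_listsUpTo.2 ⟨?_, fun y hy => ?_⟩, fun L hL => ?_, fun y' hy' => ?_, ?_⟩
  · rw [← Nat.cast_le (α := ℝ≥0∞), length_eq_tsum]
    refine (ENNReal.tsum_le_tsum hcount').trans ?_
    rw [ENNReal.tsum_mul_left, D.tsum_coe, mul_one]
  · obtain ⟨z, hz, hy'⟩ := List.mem_flatMap.1 hy
    rw [List.mem_dedup] at hz
    exact (List.eq_of_mem_replicate hy') ▸ hz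
  · -- Markov's inequality, and a rounding error of at most `1` for each string.
    have h1 : (L : ℝ≥0∞) ≤ L * ∑ y ∈ (strings L).toFinset, D y + n := by
      calc (L : ℝ≥0∞) = ∑' y, D y * L := by rw [ENNReal.tsum_mul_right, D.tsum_coe, one_mul]
        _ ≤ ∑' y, (L * (if y ∈ (strings L).toFinset then D y else 0) + D y * y.length) := by
          gcongr with y
          split_ifs with hy
          · rw [mul_comm]
            exact le_self_add
          · rw [List.mem_toFinset, mem_strings, not_le] at hy
            rw [mul_zero, zero_add]
            gcongr
        _ ≤ _ := by
          rw [ENNReal.tsum_add, ENNReal.tsum_mul_left]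
          gcongr
          · rw [tsum_eq_sum (s := (strings L).toFinset) (by simp +contextual)]
            exact Finset.sum_le_sum fun y hy => by simp [hy]
          · exact hlen
    have h2 : K * ∑ y ∈ (strings L).toFinset, D y ≤
        ((w.filter fun y => y.length ≤ L).length : ℝ≥0∞) + (strings N).length := by
      rw [length_filter_eq_sum, Finset.mul_sum]
      calc ∑ y ∈ (strings L).toFinset, K * D y
          ≤ ∑ y ∈ (strings L).toFinset, ((w.count y : ℝ≥0∞) + 1) := by
            refine Finset.sum_le_sum fun y hy => ?_
            rw [List.mem_toFinset, mem_strings] at hy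
            rw [hcount y (by omega)]
            exact hk' y
        _ ≤ _ := by
          rw [Finset.sum_add_distrib]
          gcongr
          have hsub : (strings L).toFinset ⊆ (strings N).toFinset := fun y => by
            simp only [List.mem_toFinset, mem_strings]
            omega
          simpa using (Finset.card_le_card hsub).trans (List.toFinset_card_le _)
    rw [← Nat.cast_le (α := ℝ≥0∞)]
    push_cast
    calc (K : ℝ≥0∞) * L ≤ K * (L * ∑ y ∈ (strings L).toFinset, D y + n) := by gcongr
      _ = L * (K * ∑ y ∈ (strings L).toFinset, D y) + K * n := by ring
      _ ≤ L * (((w.filter fun y => y.length ≤ L).length : ℝ≥0∞) + (strings N).length) + K * n := by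
        gcongr
      _ = _ := by rw [mul_add]
  · have h : ((w.flatMap (finals M x N)).count (some y') : ℝ≥0∞) / 2 ^ N ≤ w.count y' + 1 := by
      rw [← tsum_count_mul_evolBy, hcount y' (mem_strings.1 hy')]
      refine le_trans ?_ (hk' y')
      rw [← hD y', ← ENNReal.tsum_mul_left]
      refine ENNReal.tsum_le_tsum fun y => ?_
      rw [← mul_assoc, ← iSup_evolBy]
      exact mul_le_mul' (hcount' y) (le_iSup (fun t => evolBy M x y t y') N)
    rw [ENNReal.div_le_iff (by simp) (by simp), mul_comm] at h
    exact_mod_cast h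
  · have h : ((w.flatMap (outputs M x N)).count (some b) : ℝ≥0∞) / 2 ^ N ≤ K / 3 := by
      rw [← tsum_count_mul_outputBy, div_eq_mul_inv, ← one_div]
      refine le_trans ?_ (mul_le_mul_right hout _)
      rw [← ENNReal.tsum_mul_left]
      refine ENNReal.tsum_le_tsum fun y => ?_
      rw [← mul_assoc, ← iSup_outputBy]
      exact mul_le_mul' (hcount' y) (le_iSup (fun t => outputBy M x y t b) N)
    rw [ENNReal.div_le_iff (by simp) (by simp), ENNReal.mul_comm_div, mul_div_assoc',
      ENNReal.le_div_iff_mul_le (by simp) (by simp), mul_comm] at h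
    exact_mod_cast h

/-! ### The decision procedure -/

theorem expectation_outputProb_add_le_one (D : PMF (List Bool)) (b : Bool) :
    ∑' y, D y * outputProb M x y b + ∑' y, D y * outputProb M x y (!b) ≤ 1 := by
  rw [← ENNReal.tsum_add, ← D.tsum_coe]
  refine ENNReal.tsum_le_tsum fun y => ?_
  rw [← mul_add]
  refine mul_le_of_le_one_right' ?_
  have := outputProb_add_le_one M x y
  cases b
  · rwa [add_comm] at this
  · exact this

theorem two_thirds_add_third : (2 / 3 : ℝ≥0∞) + 1 / 3 = 1 := by
  rw [← ENNReal.add_div, two_add_one_eq_three, ENNReal.div_self (by simp) (by simp)]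

theorem LeadsTo.expectation_le {D : PMF (List Bool)} {b : Bool} (h : LeadsTo M x D (!b)) :
    ∑' y, D y * outputProb M x y b ≤ 1 / 3 := by
  have h1 := (add_le_add_right h _).trans (expectation_outputProb_add_le_one (M := M) (x := x) D b)
  rw [← two_thirds_add_third, add_comm] at h1
  exact (ENNReal.add_le_add_iff_left (by finiteness)).1 h1

theorem LeadsTo.not_le {D : PMF (List Bool)} {b : Bool} (h : LeadsTo M x D b) :
    ¬ ∑' y, D y * outputProb M x y b ≤ 1 / 3 := fun h' => by
  have : (2 / 3 : ℝ≥0∞) ≤ 1 / 3 := h.trans h'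
  rw [ENNReal.div_le_iff (by simp) (by simp), ENNReal.div_mul_cancel (by simp) (by simp)] at this
  norm_num at this

/-- `M` reaches the decision `b` on `x`. This is `Accepts M x` for `b = true` and `Rejects M x` for
`b = false`. -/
def Decides (M : Machine) (x : List Bool) (b : Bool) : Prop :=
  ∀ D : PMF (List Bool), IsFixedPoint M x D → LeadsTo M x D b

/-- The search for `b` fails at some stage if and only if `b` is the right answer: otherwise the
other bit is right, and the given fixed-point outputs `b` with probability at most `1 / 3`. -/
theorem exists_not_feasible_iff (hM : IsTMCTC M) {n : ℕ} {D : PMF (List Bool)}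
    (hD : IsFixedPoint M x D) (hlen : expectedLength D ≤ n) (b : Bool) :
    (∃ N, ¬ Feasible M x n N b) ↔ Decides M x b := by
  constructor
  · rintro ⟨N, hN⟩
    have h : Decides M x b ∨ Decides M x (!b) := by
      cases b
      · exact (hM.accepts_or_rejects x).symm
      · exact hM.accepts_or_rejects x
    refine h.resolve_right fun h => hN ?_
    exact feasible_of_fixedPoint hD hlen (h D hD).expectation_le N
  · intro h
    by_contra! hN
    obtain ⟨D', h1, h2⟩ := exists_fixedPoint_of_feasible (hM.halts x) hN
    exact (h D' h1).not_le h2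

theorem not_decides_not {D : PMF (List Bool)} (hD : IsFixedPoint M x D) {b : Bool}
    (h : Decides M x b) : ¬ Decides M x !b :=
  fun h' => (h D hD).not_le (h' D hD).expectation_le

open Classical in
/-- The result of stage `N` of the search: a bit for which no sample passes the test, if there is
one. -/
noncomputable def verdict (M : Machine) (x : List Bool) (n N : ℕ) : Option Bool :=
  if Feasible M x n N true then if Feasible M x n N false then none else some false else some true

open _root_.Primrec in
theorem primrec_verdict : Primrec fun p : ((Machine × List Bool) × ℕ) × ℕ =>
    verdict p.1.1.1 p.1.1.2 p.1.2 p.2 := by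
  classical
  have h (b : Bool) : PrimrecPred fun p : ((Machine × List Bool) × ℕ) × ℕ =>
      Feasible p.1.1.1 p.1.1.2 p.1.2 p.2 b :=
    primrecPred_feasible.comp
      (pair (fst.comp fst) (pair (snd.comp fst) (pair snd (const b))))
  exact ite (h true) (ite (h false) (const none) (const (some false))) (const (some true))

theorem not_feasible_of_mem_verdict {n N : ℕ} {b : Bool} (h : b ∈ verdict M x n N) :
    ¬ Feasible M x n N b := by
  rw [verdict] at h
  split_ifs at h <;> simp_all

theorem exists_mem_verdict {n N : ℕ} {b : Bool} (h : ¬ Feasible M x n N b) :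
    ∃ b', b' ∈ verdict M x n N := by
  rw [verdict]
  cases b <;> split_ifs <;> simp_all

end CTC

theorem theorem3 (ℓ : CTC.Machine × List Bool →. ℕ) (hℓ : Partrec ℓ) :
    ∃ A : CTC.Machine × List Bool →. Bool, Partrec A ∧
      ∀ (M : CTC.Machine) (x : List Bool), CTC.IsTMCTC M →
        (∃ n ∈ ℓ (M, x), ∃ D : PMF (List Bool),
          CTC.IsFixedPoint M x D ∧ CTC.expectedLength D ≤ (n : ℝ≥0∞)) →
        ∃ b ∈ A (M, x), (b = true ↔ CTC.Accepts M x) ∧ (b = false ↔ CTC.Rejects M x) := by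
  refine ⟨fun p => (ℓ p).bind fun n => Nat.rfindOpt (CTC.verdict p.1 p.2 n),
    hℓ.bind (Partrec.rfindOpt CTC.primrec_verdict.to_comp), ?_⟩
  rintro M x hM ⟨n, hn, D, hD, hlen⟩
  have hiff := CTC.exists_not_feasible_iff hM hD hlen
  have hdom : (Nat.rfindOpt (CTC.verdict M x n)).Dom := by
    rw [Nat.rfindOpt_dom]
    have h : ∃ b, CTC.Decides M x b :=
      (hM.accepts_or_rejects x).elim (fun h => ⟨true, h⟩) fun h => ⟨false, h⟩
    obtain ⟨b, hb⟩ := h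
    obtain ⟨N, hN⟩ := (hiff b).2 hb
    exact ⟨N, CTC.exists_mem_verdict hN⟩
  obtain ⟨b, hb⟩ := Part.dom_iff_mem.1 hdom
  obtain ⟨N, hN⟩ := Nat.rfindOpt_spec hb
  have hdec : CTC.Decides M x b := (hiff b).1 ⟨N, CTC.not_feasible_of_mem_verdict hN⟩
  refine ⟨b, Part.mem_bind hn hb, ?_⟩
  have hnot := CTC.not_decides_not hD hdec
  cases b
  · exact ⟨iff_of_false (by simp) hnot, iff_of_true rfl hdec⟩
  · exact ⟨iff_of_true rfl hdec, iff_of_false (by simp) hnot⟩
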